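/- Closed balls of $\mathbb{R}$ are the compact intervals of positive length; for $B=[c-\rho,c+\rho]$ with $\rho>0$ and an integer $u\ge 1$ let $\mathcal{S}(B,u)$ be the set of the $u$ closed intervals of length $2\rho/u$ obtained by cutting $B$ into $u$ equal parts. For a collection $\mathcal{C}$ of closed intervals put $\frac1R\mathcal{C}=\bigcup_{B\in\mathcal{C}}\mathcal{S}(B,R)$, and let $\frac{1}{R^k}\mathcal{C}$ denote its $k$-fold iterate. Let $B_0$ be a closed interval, $R\ge 1$ an integer, and $\mathbf{r}=(r_{m,n})_{0\le m\le n}$ a two-parameter sequence of nonnegative real numbers. A *$(B_0,R,\mathbf{r})$ Cantor set* is any set $\bigcap_{n\ge 0}\bigcup_{B\in\mathcal{B}_n}B$, where $\mathcal{B}_0=\{B_0\}$ and, for $n\ge 0$, $\mathcal{B}_{n+1}=\left(\frac1R\mathcal{B}_n\right)\setminus\bigcup_{m=0}^n\mathcal{A}_{m,n}$ for some collections $\mathcal{A}_{m,n}\subseteq\frac{1}{R^{n-m+1}}\mathcal{B}_m$ $(0\le m\le n)$ such that $\#\{A\in\mathcal{A}_{m,n}: A\subseteq B\}\le r_{m,n}$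 for every $B\in\mathcal{B}_m$. For $0<\varepsilon_0\le 1$, a set $E\subseteq\mathbb{R}$ is *$\varepsilon_0$ Cantor winning in $B_0$* if for every $0<\varepsilon<\varepsilon_0$ there is an integer $R_\varepsilon\ge 1$ such that for every integer $R\ge R_\varepsilon$ the set $E$ contains a $(B_0,R,\mathbf{r})$ Cantor set with $r_{m,n}\le R^{(n-m+1)(1-\varepsilon)}$ for all $0\le m\le n$; $E$ is *Cantor winning in $B_0$* if it is $\varepsilon_0$ Cantor winning in $B_0$ for some $\varepsilon_0\in(0,1]$. For a real $M\ge 4$, a set $E\subseteq\mathbb{R}$ is *$(B_0,M)$ Cantor rich* if for every integer $R>M$ and every $0<y<1$ the set $E$ contains a $(B_0,R,\mathbf{r})$ Cantor set with $\sum_{m=0}^{n}\left(\frac4R\right)^{n-m+1}r_{m,n}\le y$ for every $n\ge 0$; $E$ is *Cantor rich in $B_0$* if it is $(B_0,M)$ Cantor rich for some $M\ge 4$. **Theorem.** Let $B_0$ be a closed interval of positive length and $E\subseteq\mathbb{R}$. Then $E$ is Cantor rich in $B_0$ if and only if $E$ is Cantor winning in $B_0$. Quantitatively: 1. If $0<\varepsilon\le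 1$ and $E$ is $\varepsilon$ Cantor winning in $B_0$, then $E$ is $(B_0,M)$ Cantor rich with $M=4^{1/\varepsilon}$. 2. If $M\ge 4$ is a real number and $E$ is $(B_0,M)$ Cantor rich, then the equation $\lfloor M\rfloor+1=4^{1/\varepsilon}$ has a unique solution $\varepsilon>0$, this solution satisfies $\varepsilon\le 1$, and $E$ is $\varepsilon$ Cantor winning in $B_0$. -/

import Mathlib

/-- A nondegenerate closed ball of `ℝ`, given by its center and its positive radius, that is,
the compact interval `[center - radius, center + radius]`. -/
@[ext]
structure RealBall where
  center : ℝ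
  radius : ℝ
  radius_pos : 0 < radius

namespace RealBall

/-- The set of points of a closed ball. -/
def carrier (B : RealBall) : Set ℝ := Metric.closedBall B.center B.radius

/-- The standard splitting structure on `ℝ`: the `u` closed intervals of radius `radius / u` into
which the interval `B` is cut (there are none when `u = 0`). Here `f u = u`. -/
def split (B : RealBall) (u : ℕ) : Set RealBall :=
  {S | ∃ i : ℕ, i < u ∧
    S.center = B.center - B.radius + (2 * (i : ℝ) + 1) * (B.radius / u) ∧
    S.radius = B.radius / u}

/-- The collection `(1 / R) 𝓒`, the union of the splittings of the members of `𝓒` into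
`R` parts. -/
def refine (R : ℕ) (𝓒 : Set RealBall) : Set RealBall := ⋃ B ∈ 𝓒, B.split R

end RealBall

/-- `𝓑` and `𝓐` are the surviving and the removed collections of a generalised Cantor set
construction with data `(B₀, R, r)`. The set `𝓐 m n` matters only for `m ≤ n`, and then it is
finite, being contained in the `(n - m + 1)`-fold refinement of the finite collection `𝓑 m`, so
that `Set.ncard` is the number of elements in the field `card_le`. -/
structure IsCantorConstruction (B₀ : RealBall) (R : ℕ) (r : ℕ → ℕ → ℝ)
    (𝓑 : ℕ → Set RealBall) (𝓐 : ℕ → ℕ → Set RealBall) : Prop where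
  zero : 𝓑 0 = {B₀}
  removed_subset : ∀ m n : ℕ, m ≤ n → 𝓐 m n ⊆ (RealBall.refine R)^[n - m + 1] (𝓑 m)
  card_le : ∀ m n : ℕ, m ≤ n → ∀ B ∈ 𝓑 m,
    (({A ∈ 𝓐 m n | A.carrier ⊆ B.carrier}.ncard : ℕ) : ℝ) ≤ r m n
  succ : ∀ n : ℕ, 𝓑 (n + 1) = RealBall.refine R (𝓑 n) \ ⋃ m ∈ Set.Iic n, 𝓐 m n

/-- `K` is a `(B₀, R, r)` Cantor set, where `r = (r m n)` for `0 ≤ m ≤ n` is a two-parameter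
sequence of nonnegative real numbers. -/
def IsCantorSet (B₀ : RealBall) (R : ℕ) (r : ℕ → ℕ → ℝ) (K : Set ℝ) : Prop :=
  (∀ m n : ℕ, m ≤ n → 0 ≤ r m n) ∧
    ∃ (𝓑 : ℕ → Set RealBall) (𝓐 : ℕ → ℕ → Set RealBall),
      IsCantorConstruction B₀ R r 𝓑 𝓐 ∧ K = ⋂ n : ℕ, ⋃ B ∈ 𝓑 n, B.carrier

/-- `E` is `ε₀` Cantor winning on `B₀` (meant for `0 < ε₀ ≤ 1`), with respect to the standard
splitting structure on `ℝ`. -/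
def IsEpsCantorWinningOn (ε₀ : ℝ) (B₀ : RealBall) (E : Set ℝ) : Prop :=
  ∀ ε : ℝ, 0 < ε → ε < ε₀ → ∃ Rε : ℕ, 1 ≤ Rε ∧ ∀ R : ℕ, Rε ≤ R →
    ∃ (r : ℕ → ℕ → ℝ) (K : Set ℝ), IsCantorSet B₀ R r K ∧ K ⊆ E ∧
      ∀ m n : ℕ, m ≤ n → r m n ≤ (R : ℝ) ^ (((n : ℝ) - (m : ℝ) + 1) * (1 - ε))

/-- `E` is Cantor winning on `B₀`. -/
def IsCantorWinningOn (B₀ : RealBall) (E : Set ℝ) : Prop :=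
  ∃ ε₀ : ℝ, 0 < ε₀ ∧ ε₀ ≤ 1 ∧ IsEpsCantorWinningOn ε₀ B₀ E

/-- `E` is `(B₀, M)` Cantor rich (meant for `4 ≤ M`). -/
def IsMCantorRich (B₀ : RealBall) (M : ℝ) (E : Set ℝ) : Prop :=
  ∀ R : ℕ, M < (R : ℝ) → ∀ y : ℝ, 0 < y → y < 1 →
    ∃ (r : ℕ → ℕ → ℝ) (K : Set ℝ), IsCantorSet B₀ R r K ∧ K ⊆ E ∧
      ∀ n : ℕ, ∑ m ∈ Finset.range (n + 1), (4 / (R : ℝ)) ^ (n - m + 1) * r m n ≤ y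

/-- `E` is Cantor rich in `B₀`. -/
def IsCantorRichIn (B₀ : RealBall) (E : Set ℝ) : Prop :=
  ∃ M : ℝ, 4 ≤ M ∧ IsMCantorRich B₀ M E

/-! Both properties bound the removals of a Cantor construction, rich in a fixed base for every `y`,
winning in all large bases by a power. The bridge is a change of base,
`IsCantorConstruction.exists_isCantorSet_subset`: from an `N`-adic construction one builds an
`R`-adic one by deleting every `R`-adic interval that meets a removed `N`-adic interval. When the
levels are compared suitably, this multiplies the counts by at most 9.

Winning implies rich: pick `ε < ε₀` with `R ^ ε > 4` and apply winning in base `R ^ k`. Back in base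
`R`, only removals spanning at least `k` levels occur, so the weighted sums are at most 9 times the
tail from `k` of a geometric series of ratio `4 / R ^ ε < 1`. This is below `y` for large `k`.

Rich implies winning: use the single base `N = ⌊M⌋ + 1` with `y` tiny in terms of the target base
`R`. One term of the sum already gives `r i j ≤ y * (N / 4) ^ (j - i + 1)`, and `N / 4 = N ^ (1 -
ε₀)`. Rounding levels to powers of `R` and merging pairs costs only a bounded power of `R`, which
`y` absorbs. -/

namespace RealBall

/-! ### Geometry of the iterated grids -/

theorem mem_carrier {B : RealBall} {x : ℝ} :
    x ∈ B.carrier ↔ B.center - B.radius ≤ x ∧ x ≤ B.center + B.radius := by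
  rw [carrier, Real.closedBall_eq_Icc, Set.mem_Icc]

theorem carrier_subset_of_mem_split {B S : RealBall} {u : ℕ} (h : S ∈ B.split u) :
    S.carrier ⊆ B.carrier := by
  obtain ⟨i, hi, hc, hr⟩ := h
  intro x hx
  rw [mem_carrier] at hx ⊢
  have hu : (0 : ℝ) < u := by exact_mod_cast (Nat.zero_le i).trans_lt hi
  have hi' : (i : ℝ) + 1 ≤ u := by exact_mod_cast hi
  have hδ : 0 < B.radius / u := div_pos B.radius_pos hu
  have hB : B.radius = u * (B.radius / u) := by field_simp
  rw [hc, hr] at hx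
  set δ := B.radius / u
  have h1 : 0 ≤ (i : ℝ) * δ := by positivity
  have h2 : ((i : ℝ) + 1) * δ ≤ u * δ := by gcongr
  constructor <;> nlinarith

theorem exists_mem_split {B : RealBall} {u : ℕ} (hu : 0 < u) {x : ℝ} (hx : x ∈ B.carrier) :
    ∃ S ∈ B.split u, x ∈ S.carrier := by
  rw [mem_carrier] at hx
  have hu' : (0 : ℝ) < u := by exact_mod_cast hu
  have hδ : 0 < B.radius / u := div_pos B.radius_pos hu'
  have hB : B.radius = u * (B.radius / u) := by field_simp
  set δ := B.radius / u with hδ'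
  suffices ∃ i : ℕ, i < u ∧ B.center - B.radius + 2 * i * δ ≤ x ∧
      x ≤ B.center - B.radius + 2 * (i + 1) * δ by
    obtain ⟨i, hi, h1, h2⟩ := this
    refine ⟨⟨B.center - B.radius + (2 * (i : ℝ) + 1) * δ, δ, hδ⟩, ⟨i, hi, rfl, rfl⟩, ?_⟩
    rw [mem_carrier]
    constructor <;> simp only <;> linarith
  set t := (x - (B.center - B.radius)) / (2 * δ) with ht
  have hxt : x = B.center - B.radius + 2 * t * δ := by rw [ht]; field_simp; ring
  have ht0 : 0 ≤ t := div_nonneg (by linarith) (by positivity)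
  by_cases h : ⌊t⌋₊ < u
  · refine ⟨⌊t⌋₊, h, ?_, ?_⟩
    · have := mul_le_mul_of_nonneg_right (Nat.floor_le ht0) hδ.le
      linarith
    · have := mul_le_mul_of_nonneg_right (Nat.lt_floor_add_one t).le hδ.le
      linarith
  -- Here `x` is the right endpoint of `B`, which belongs to the last piece.
  · have hut : (u : ℝ) ≤ t := (Nat.le_floor_iff ht0).1 (not_lt.1 h)
    have h1 := mul_le_mul_of_nonneg_right hut hδ.le
    obtain ⟨v, rfl⟩ : ∃ v, u = v + 1 := ⟨u - 1, by omega⟩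
    push_cast at *
    exact ⟨v, by omega, by linarith, by linarith⟩

theorem refine_mono (R : ℕ) : Monotone (refine R) := fun _ _ h =>
  Set.biUnion_subset_biUnion_left h

theorem exists_carrier_subset_of_mem_iterate_refine {R k : ℕ} {𝓒 : Set RealBall} {S : RealBall}
    (h : S ∈ (refine R)^[k] 𝓒) : ∃ C ∈ 𝓒, S.carrier ⊆ C.carrier := by
  induction k generalizing S with
  | zero => exact ⟨S, h, subset_rfl⟩
  | succ k ih =>
    rw [Function.iterate_succ_apply', refine, Set.mem_iUnion₂] at h
    obtain ⟨T, hT, hS⟩ := h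
    obtain ⟨C, hC, hTC⟩ := ih hT
    exact ⟨C, hC, (carrier_subset_of_mem_split hS).trans hTC⟩

theorem exists_index_of_mem_iterate_refine {B₀ S : RealBall} {R n : ℕ}
    (h : S ∈ (refine R)^[n] {B₀}) : ∃ i : ℕ, i < R ^ n ∧
      S.center = B₀.center - B₀.radius + (2 * (i : ℝ) + 1) * (B₀.radius / (R : ℝ) ^ n) ∧
      S.radius = B₀.radius / (R : ℝ) ^ n := by
  induction n generalizing S with
  | zero =>
    obtain rfl : S = B₀ := h
    exact ⟨0, by simp, by simp, by simp⟩
  | succ n ih =>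
    rw [Function.iterate_succ_apply', refine, Set.mem_iUnion₂] at h
    obtain ⟨T, hT, j, hj, hc, hr⟩ := h
    obtain ⟨i, hi, hTc, hTr⟩ := ih hT
    have hR : (R : ℝ) ≠ 0 := by exact_mod_cast ((Nat.zero_le j).trans_lt hj).ne'
    -- Indices are base `R` numerals: refining appends the digit `j`.
    refine ⟨i * R + j, ?_, ?_, ?_⟩
    · calc i * R + j < i * R + R := by omega
        _ = (i + 1) * R := by ring
        _ ≤ R ^ n * R := Nat.mul_le_mul_right _ hi
        _ = R ^ (n + 1) := (pow_succ _ _).symm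
    · rw [hc, hTc, hTr]
      push_cast
      field_simp
      ring
    · rw [hr, hTr, pow_succ, div_div]

theorem finite_iterate_refine (B₀ : RealBall) (R n : ℕ) : ((refine R)^[n] {B₀}).Finite := by
  have hfin : (((fun i : ℕ => (B₀.center - B₀.radius +
      (2 * (i : ℝ) + 1) * (B₀.radius / (R : ℝ) ^ n), B₀.radius / (R : ℝ) ^ n)) ''
        Set.Iio (R ^ n))).Finite := (Set.finite_Iio _).image _
  refine Set.Finite.of_finite_image (f := fun S : RealBall => (S.center, S.radius))
    (hfin.subset ?_) ?_
  · rintro _ ⟨S, hS, rfl⟩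
    obtain ⟨i, hi, hc, hr⟩ := exists_index_of_mem_iterate_refine hS
    exact ⟨i, hi, by simp only [hc, hr]⟩
  · intro S _ T _ h
    exact RealBall.ext (congrArg Prod.fst h) (congrArg Prod.snd h)

/-- In units of the grid length `2 * δ`, an interval no longer than a grid cell meets only cells
with index in some `[t, t + 2]`, which holds at most three integers. Touching at endpoints is
counted. -/
theorem ncard_meeting_le_three {B₀ B : RealBall} {R n : ℕ}
    (hB : B.radius ≤ B₀.radius / (R : ℝ) ^ n) :
    {S ∈ (refine R)^[n] {B₀} | (S.carrier ∩ B.carrier).Nonempty}.ncard ≤ 3 := by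
  have hδ : 0 < B₀.radius / (R : ℝ) ^ n := B.radius_pos.trans_le hB
  set δ := B₀.radius / (R : ℝ) ^ n with hδ'
  set b := B₀.center - B₀.radius with hb
  set t := (B.center - B.radius - b) / (2 * δ) - 1 with ht
  have htb : B.center - B.radius = b + 2 * (t + 1) * δ := by rw [ht]; field_simp; ring
  let g : ℤ → RealBall := fun i => ⟨b + (2 * (i : ℝ) + 1) * δ, δ, hδ⟩
  calc _ ≤ (g '' (Finset.Icc ⌈t⌉ (⌈t⌉ + 2) : Finset ℤ)).ncard := by
        refine Set.ncard_le_ncard ?_ ((Finset.finite_toSet _).image _)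
        rintro S ⟨hS, x, hxS, hxB⟩
        obtain ⟨i, -, hc, hr⟩ := exists_index_of_mem_iterate_refine hS
        rw [mem_carrier] at hxS hxB
        rw [hc, hr] at hxS
        have h1 : t ≤ i := by
          by_contra! hlt
          have := mul_lt_mul_of_pos_right hlt hδ
          linarith [hxS.1, hxS.2, hxB.1, hxB.2]
        have h2 : (i : ℝ) ≤ t + 2 := by
          by_contra! hlt
          have := mul_lt_mul_of_pos_right hlt hδ
          linarith [hxS.1, hxS.2, hxB.1, hxB.2]
        refine ⟨(i : ℤ), ?_, RealBall.ext (by simpa [g] using hc.symm) (by simpa [g] using hr.symm)⟩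
        rw [Finset.coe_Icc, Set.mem_Icc]
        refine ⟨Int.ceil_le.2 (by exact_mod_cast h1), ?_⟩
        have h3 := Int.le_ceil t
        have : ((i : ℤ) : ℝ) ≤ ((⌈t⌉ + 2 : ℤ) : ℝ) := by push_cast; linarith
        exact_mod_cast this
    _ ≤ ((Finset.Icc ⌈t⌉ (⌈t⌉ + 2) : Finset ℤ) : Set ℤ).ncard :=
        Set.ncard_image_le (Finset.finite_toSet _)
    _ = 3 := by rw [Set.ncard_coe_finset, Int.card_Icc]; omega

end RealBall

open RealBall

/-! ### Counting in unions and descendants -/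

theorem Set.Finite.ncard_biUnion_le_mul {α β : Type*} {s : Set α} (hs : s.Finite) (f : α → Set β)
    {c : ℝ} (hf : ∀ a ∈ s, ((f a).ncard : ℝ) ≤ c) :
    ((⋃ a ∈ s, f a).ncard : ℝ) ≤ s.ncard * c := by
  induction s, hs using Set.Finite.induction_on with
  | empty => simp
  | @insert a s ha hs ih =>
    rw [Set.biUnion_insert, Set.ncard_insert_of_notMem ha hs]
    have h1 : ((f a ∪ ⋃ x ∈ s, f x).ncard : ℝ) ≤ (f a).ncard + (⋃ x ∈ s, f x).ncard := by
      exact_mod_cast Set.ncard_union_le _ _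
    have h2 := ih fun x hx => hf x (Set.mem_insert_of_mem _ hx)
    have h3 := hf a (Set.mem_insert _ _)
    push_cast
    linarith

theorem Finset.ncard_biUnion_le_sum {α β : Type*} (s : Finset α) (f : α → Set β) :
    (⋃ a ∈ s, f a).ncard ≤ ∑ a ∈ s, (f a).ncard := by
  classical
  induction s using Finset.induction_on with
  | empty => simp
  | insert a s ha ih =>
    rw [Finset.set_biUnion_insert, Finset.sum_insert ha]
    exact (Set.ncard_union_le _ _).trans (by omega)

theorem subset_iterate_refine_of_forall_succ {R : ℕ} {𝓑 : ℕ → Set RealBall}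
    (h : ∀ n, 𝓑 (n + 1) ⊆ refine R (𝓑 n)) (m k : ℕ) :
    𝓑 (m + k) ⊆ (refine R)^[k] (𝓑 m) := by
  induction k with
  | zero => exact subset_rfl
  | succ k ih =>
    rw [Function.iterate_succ_apply']
    exact (h _).trans (refine_mono R ih)

/-! ### Change of base -/

namespace IsCantorConstruction

variable {B₀ : RealBall} {N R : ℕ} {r : ℕ → ℕ → ℝ} {𝓑 : ℕ → Set RealBall}
  {𝓐 : ℕ → ℕ → Set RealBall}

theorem succ_subset (h : IsCantorConstruction B₀ N r 𝓑 𝓐) (n : ℕ) :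
    𝓑 (n + 1) ⊆ refine N (𝓑 n) := by
  rw [h.succ]
  exact Set.sdiff_subset

theorem subset_iterate (h : IsCantorConstruction B₀ N r 𝓑 𝓐) (n : ℕ) :
    𝓑 n ⊆ (refine N)^[n] {B₀} := by
  have := subset_iterate_refine_of_forall_succ h.succ_subset 0 n
  rwa [h.zero, Nat.zero_add] at this

theorem removed_subset_iterate (h : IsCantorConstruction B₀ N r 𝓑 𝓐) {m n : ℕ} (hmn : m ≤ n) :
    𝓐 m n ⊆ (refine N)^[n + 1] {B₀} := by
  refine (h.removed_subset m n hmn).trans ?_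
  have := (refine_mono N).iterate (n - m + 1) (h.subset_iterate m)
  rwa [← Function.iterate_add_apply, show n - m + 1 + m = n + 1 by omega] at this

/-- The factor is `3 * 3`: `B` is no longer than an `N`-adic interval of level `i`, so it meets at
most three of them; each surviving one contains at most `r i j` removed intervals; and each of these
is no longer than an `R`-adic interval of level `n + 1`, so it meets at most three. -/
theorem ncard_removed_meeting_le (h : IsCantorConstruction B₀ N r 𝓑 𝓐)
    (hr : ∀ m n, m ≤ n → 0 ≤ r m n) (hN : 0 < N) {i j m n : ℕ} (hij : i ≤ j) (hm : N ^ i ≤ R ^ m) (hn : R ^ (n + 1) ≤ N ^ (j + 1))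
    (hR : 0 < R) {B : RealBall} (hB : B ∈ (refine R)^[m] {B₀}) :
    ({S ∈ (refine R)^[n + 1] {B₀} | S.carrier ⊆ B.carrier ∧
      ∃ A ∈ 𝓐 i j, (S.carrier ∩ A.carrier).Nonempty}.ncard : ℝ) ≤ 9 * r i j := by
  set 𝓒 : Set RealBall := {C ∈ (refine N)^[i] {B₀} | (C.carrier ∩ B.carrier).Nonempty} with h𝓒
  have h𝓒fin : 𝓒.Finite := (finite_iterate_refine B₀ N i).subset fun _ h => h.1
  have hBr : B.radius ≤ B₀.radius / (N : ℝ) ^ i := by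
    obtain ⟨-, -, -, hr⟩ := exists_index_of_mem_iterate_refine hB
    rw [hr]
    have := B₀.radius_pos.le
    gcongr
    exact_mod_cast hm
  have h𝓒card : (𝓒.ncard : ℝ) ≤ 3 := by exact_mod_cast ncard_meeting_le_three hBr
  -- Requiring `C ∈ 𝓑 i` empties `𝓓 C` for the other grid cells, where `card_le` gives no bound.
  set 𝓓 : RealBall → Set RealBall := fun C => {A ∈ 𝓐 i j | C ∈ 𝓑 i ∧ A.carrier ⊆ C.carrier} with h𝓓
  have h𝓓fin : ∀ C, (𝓓 C).Finite := fun C =>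
    (finite_iterate_refine B₀ N (j + 1)).subset fun _ hA => h.removed_subset_iterate hij hA.1
  have h𝓓card : ∀ C, ((𝓓 C).ncard : ℝ) ≤ r i j := by
    intro C
    by_cases hC : C ∈ 𝓑 i
    · simpa only [h𝓓, hC, true_and] using h.card_le i j hij C hC
    · simpa [h𝓓, hC] using hr i j hij
  set 𝓔 : RealBall → Set RealBall := fun A =>
    {S ∈ (refine R)^[n + 1] {B₀} | (S.carrier ∩ A.carrier).Nonempty} with h𝓔
  have h𝓔card : ∀ C, ∀ A ∈ 𝓓 C, ((𝓔 A).ncard : ℝ) ≤ 3 := by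
    intro C A hA
    have : A.radius ≤ B₀.radius / (R : ℝ) ^ (n + 1) := by
      obtain ⟨-, -, -, hr⟩ :=
        exists_index_of_mem_iterate_refine (h.removed_subset_iterate hij hA.1)
      rw [hr]
      have := B₀.radius_pos.le
      gcongr
      exact_mod_cast hn
    exact_mod_cast ncard_meeting_le_three this
  have hsub : {S ∈ (refine R)^[n + 1] {B₀} | S.carrier ⊆ B.carrier ∧
      ∃ A ∈ 𝓐 i j, (S.carrier ∩ A.carrier).Nonempty} ⊆ ⋃ C ∈ 𝓒, ⋃ A ∈ 𝓓 C, 𝓔 A := by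
    rintro S ⟨hS, hSB, A, hA, x, hxS, hxA⟩
    obtain ⟨C, hC, hAC⟩ :=
      exists_carrier_subset_of_mem_iterate_refine (h.removed_subset i j hij hA)
    simp only [Set.mem_iUnion]
    exact ⟨C, ⟨h.subset_iterate i hC, x, hAC hxA, hSB hxS⟩, A, ⟨hA, hC, hAC⟩, hS, x, hxS, hxA⟩
  have hfin : (⋃ C ∈ 𝓒, ⋃ A ∈ 𝓓 C, 𝓔 A).Finite :=
    (finite_iterate_refine B₀ R (n + 1)).subset
      (Set.iUnion₂_subset fun _ _ => Set.iUnion₂_subset fun _ _ _ h => h.1)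
  have hrij := hr i j hij
  calc _ ≤ ((⋃ C ∈ 𝓒, ⋃ A ∈ 𝓓 C, 𝓔 A).ncard : ℝ) := by
        exact_mod_cast Set.ncard_le_ncard hsub hfin
    _ ≤ 𝓒.ncard * (r i j * 3) := by
        refine h𝓒fin.ncard_biUnion_le_mul _ fun C _ => ?_
        refine ((h𝓓fin C).ncard_biUnion_le_mul _ (h𝓔card C)).trans ?_
        gcongr
        exact h𝓓card C
    _ ≤ 3 * (r i j * 3) := by gcongr
    _ = 9 * r i j := by ring

/-- Change of base: a Cantor set built by `N`-adic splittings contains one built by `R`-adic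
splittings. The pairs `(i, j) ∈ P m n` are those for which the removal of `𝓐 i j` is carried out
in the removal with index `(m, n)`. -/
theorem exists_isCantorSet_subset (h : IsCantorConstruction B₀ N r 𝓑 𝓐)
    (hr : ∀ m n, m ≤ n → 0 ≤ r m n) (hN : 0 < N) (hR : 0 < R) (P : ℕ → ℕ → Finset (ℕ × ℕ))
    (hP : ∀ m n, m ≤ n → ∀ p ∈ P m n, p.1 ≤ p.2 ∧ N ^ p.1 ≤ R ^ m ∧ R ^ (n + 1) ≤ N ^ (p.2 + 1))
    (hcov : ∀ i j, i ≤ j → 1 ≤ r i j → ∃ m n, m ≤ n ∧ (i, j) ∈ P m n) :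
    ∃ K, IsCantorSet B₀ R (fun m n => ∑ p ∈ P m n, 9 * r p.1 p.2) K ∧
      K ⊆ ⋂ n, ⋃ B ∈ 𝓑 n, B.carrier := by
  let bad : ℕ → ℕ → Set RealBall := fun m n =>
    {S | ∃ p ∈ P m n, ∃ A ∈ 𝓐 p.1 p.2, (S.carrier ∩ A.carrier).Nonempty}
  let 𝓑' : ℕ → Set RealBall := fun n =>
    Nat.rec {B₀} (fun n 𝓒 => refine R 𝓒 \ ⋃ m ∈ Set.Iic n, bad m n) n
  -- Intersecting with the descendants of `𝓑' m` makes `removed_subset` hold and, by `hdesc`, does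
  -- not change what is deleted.
  let 𝓐' : ℕ → ℕ → Set RealBall := fun m n => (refine R)^[n - m + 1] (𝓑' m) ∩ bad m n
  have hsucc : ∀ n, 𝓑' (n + 1) = refine R (𝓑' n) \ ⋃ m ∈ Set.Iic n, bad m n := fun n => rfl
  have hsub : ∀ n, 𝓑' (n + 1) ⊆ refine R (𝓑' n) := fun n => Set.sdiff_subset
  have hgrid : ∀ n, 𝓑' n ⊆ (refine R)^[n] {B₀} := fun n => by
    have := subset_iterate_refine_of_forall_succ hsub 0 n
    rwa [Nat.zero_add] at this
  have hdesc : ∀ m n, m ≤ n → refine R (𝓑' n) ⊆ (refine R)^[n - m + 1] (𝓑' m) := fun m n hmn => by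
    rw [Function.iterate_succ_apply']
    refine refine_mono R ?_
    have := subset_iterate_refine_of_forall_succ hsub m (n - m)
    rwa [Nat.add_sub_cancel' hmn] at this
  refine ⟨⋂ n, ⋃ B ∈ 𝓑' n, B.carrier, ⟨fun m n hmn => Finset.sum_nonneg fun p hp =>
    mul_nonneg (by norm_num) (hr _ _ (hP m n hmn p hp).1), 𝓑', 𝓐', ⟨rfl, fun m n _ =>
      Set.inter_subset_left, fun m n hmn B hB => ?_, fun n => ?_⟩, rfl⟩, ?_⟩
  · let F : ℕ × ℕ → Set RealBall := fun p => {S ∈ (refine R)^[n + 1] {B₀} |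
      S.carrier ⊆ B.carrier ∧ ∃ A ∈ 𝓐 p.1 p.2, (S.carrier ∩ A.carrier).Nonempty}
    have hF : {A ∈ 𝓐' m n | A.carrier ⊆ B.carrier} ⊆ ⋃ p ∈ P m n, F p := by
      rintro S ⟨⟨hS, p, hp, hpS⟩, hSB⟩
      simp only [Set.mem_iUnion]
      refine ⟨p, hp, ?_, hSB, hpS⟩
      have := (refine_mono R).iterate (n - m + 1) (hgrid m) hS
      rwa [← Function.iterate_add_apply, show n - m + 1 + m = n + 1 by omega] at this
    have hfin : (⋃ p ∈ P m n, F p).Finite :=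
      (finite_iterate_refine B₀ R (n + 1)).subset (Set.iUnion₂_subset fun _ _ _ h => h.1)
    calc _ ≤ ((⋃ p ∈ P m n, F p).ncard : ℝ) := by exact_mod_cast Set.ncard_le_ncard hF hfin
      _ ≤ ∑ p ∈ P m n, ((F p).ncard : ℝ) := by exact_mod_cast Finset.ncard_biUnion_le_sum _ _
      _ ≤ ∑ p ∈ P m n, 9 * r p.1 p.2 := Finset.sum_le_sum fun p hp => by
          obtain ⟨h1, h2, h3⟩ := hP m n hmn p hp
          exact h.ncard_removed_meeting_le hr hN h1 h2 h3 hR (hgrid m hB)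
  · rw [hsucc]
    ext S
    simp only [Set.mem_sdiff, Set.mem_iUnion, not_exists, 𝓐', Set.mem_inter_iff, not_and]
    exact ⟨fun ⟨h1, h2⟩ => ⟨h1, fun m hm _ => h2 m hm⟩,
      fun ⟨h1, h2⟩ => ⟨h1, fun m hm => h2 m hm (hdesc m n hm h1)⟩⟩
  · intro x hx
    simp only [Set.mem_iInter, Set.mem_iUnion, exists_prop] at hx ⊢
    -- The surviving `N`-adic intervals around `x` are found level by level: were the next one `D`
    -- removed, the `R`-adic interval around `x` at level `n + 1` would meet `D` at `x` and hence
    -- have been deleted.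
    intro k
    induction k with
    | zero => simpa [h.zero, 𝓑'] using hx 0
    | succ j ih =>
      obtain ⟨C, hC, hxC⟩ := ih
      obtain ⟨D, hD, hxD⟩ := exists_mem_split hN hxC
      refine ⟨D, ?_, hxD⟩
      rw [h.succ]
      refine ⟨Set.mem_biUnion hC hD, fun hmem => ?_⟩
      simp only [Set.mem_iUnion, Set.mem_Iic] at hmem
      obtain ⟨i, hij, hDA⟩ := hmem
      obtain ⟨E, hE, hDE⟩ :=
        exists_carrier_subset_of_mem_iterate_refine (h.removed_subset i j hij hDA)
      -- An actual removal forces a bound of at least one, so pairs with `r i j < 1` need no place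
      -- in `P`.
      have hone : 1 ≤ r i j := by
        refine le_trans ?_ (h.card_le i j hij E hE)
        have hfin : {A ∈ 𝓐 i j | A.carrier ⊆ E.carrier}.Finite :=
          (finite_iterate_refine B₀ N (j + 1)).subset fun _ hA => h.removed_subset_iterate hij hA.1
        exact_mod_cast (Set.ncard_pos hfin).2 ⟨D, hDA, hDE⟩
      obtain ⟨m, n, hmn, hp⟩ := hcov i j hij hone
      obtain ⟨S, hS, hxS⟩ := hx (n + 1)
      rw [hsucc] at hS
      refine hS.2 ?_
      simp only [Set.mem_iUnion]
      exact ⟨m, hmn, (i, j), hp, D, hDA, x, hxS, hxD⟩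

end IsCantorConstruction


/-! ### Rounding `N`-adic levels to `R`-adic ones -/

theorem Finset.card_le_of_forall_lt_add {s : Finset ℕ} {R : ℕ}
    (h : ∀ a ∈ s, ∀ b ∈ s, a ≤ b → b < a + R) : s.card ≤ R := by
  obtain rfl | hs := s.eq_empty_or_nonempty
  · simp
  · calc s.card ≤ (Finset.Ico (s.min' hs) (s.min' hs + R)).card :=
          Finset.card_le_card fun b hb => Finset.mem_Ico.2
            ⟨s.min'_le b hb, h _ (s.min'_mem hs) b hb (s.min'_le b hb)⟩
      _ = R := by simp

theorem Nat.pow_clog_le_mul {R x : ℕ} (hR : 1 < R) (hx : 0 < x) : R ^ Nat.clog R x ≤ R * x := by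
  obtain rfl | hx1 := (Nat.succ_le_of_lt hx).eq_or_lt
  · simpa using hR.le
  · have h1 := Nat.pow_pred_clog_lt_self hR hx1
    have h2 : Nat.clog R x = (Nat.clog R x).pred + 1 :=
      (Nat.succ_pred_eq_of_pos (Nat.clog_pos hR hx1)).symm
    rw [h2, pow_succ, mul_comm]
    exact Nat.mul_le_mul_left _ h1.le

theorem Nat.lt_add_of_pow_le_mul_pow {N R a b : ℕ} (hN : 1 < N) (hab : a ≤ b)
    (h : N ^ b ≤ R * N ^ a) : b < a + R := by
  obtain ⟨c, rfl⟩ := Nat.exists_eq_add_of_le hab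
  rw [pow_add, mul_comm] at h
  have := (Nat.lt_pow_self hN).trans_le (Nat.le_of_mul_le_mul_right h (by positivity))
  exact Nat.add_lt_add_left this a

/-- The pairs `(i, j)` with `i ≤ j` such that `R ^ m` is the least power of `R` above `N ^ i` and
`R ^ (n + 1)` is the largest power of `R` below `N ^ (j + 1)`. -/
def basePairs (N R m n : ℕ) : Finset (ℕ × ℕ) :=
  {p ∈ Finset.range (R ^ m) ×ˢ Finset.range (R ^ (n + 2)) |
    p.1 ≤ p.2 ∧ Nat.clog R (N ^ p.1) = m ∧ Nat.log R (N ^ (p.2 + 1)) = n + 1}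

theorem mem_basePairs {N R m n : ℕ} (hN : 1 < N) (hR : 1 < R) {p : ℕ × ℕ} :
    p ∈ basePairs N R m n ↔
      p.1 ≤ p.2 ∧ Nat.clog R (N ^ p.1) = m ∧ Nat.log R (N ^ (p.2 + 1)) = n + 1 := by
  rw [basePairs, Finset.mem_filter, Finset.mem_product, Finset.mem_range, Finset.mem_range]
  refine ⟨fun h => h.2, fun h => ⟨⟨?_, ?_⟩, h⟩⟩
  · rw [← h.2.1]
    exact (Nat.lt_pow_self hN).trans_le (Nat.le_pow_clog hR _)
  · have h1 := Nat.lt_pow_succ_log_self hR (N ^ (p.2 + 1))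
    rw [h.2.2] at h1
    exact (Nat.lt_succ_self _).trans ((Nat.lt_pow_self hN).trans h1)

/-- For fixed `m` the values `N ^ i` lie within a factor `R` of each other, so fewer than `R` steps
separate the exponents, as `c < N ^ c`. The same holds for `j` and `n`. -/
theorem card_basePairs_le {N R : ℕ} (hN : 1 < N) (hR : 1 < R) (m n : ℕ) :
    (basePairs N R m n).card ≤ R ^ 2 := by
  have h1 : ((basePairs N R m n).image Prod.fst).card ≤ R := by
    refine Finset.card_le_of_forall_lt_add ?_
    simp only [Finset.mem_image]
    rintro _ ⟨p, hp, rfl⟩ _ ⟨q, hq, rfl⟩ hpq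
    refine Nat.lt_add_of_pow_le_mul_pow hN hpq ?_
    calc N ^ q.1 ≤ R ^ Nat.clog R (N ^ q.1) := Nat.le_pow_clog hR _
      _ = R ^ Nat.clog R (N ^ p.1) := by
        rw [((mem_basePairs hN hR).1 hp).2.1, ((mem_basePairs hN hR).1 hq).2.1]
      _ ≤ R * N ^ p.1 := Nat.pow_clog_le_mul hR (by positivity)
  have h2 : ((basePairs N R m n).image Prod.snd).card ≤ R := by
    refine Finset.card_le_of_forall_lt_add ?_
    simp only [Finset.mem_image]
    rintro _ ⟨p, hp, rfl⟩ _ ⟨q, hq, rfl⟩ hpq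
    have key : q.2 + 1 < p.2 + 1 + R := by
      refine Nat.lt_add_of_pow_le_mul_pow hN (by omega) ?_
      calc N ^ (q.2 + 1) ≤ R ^ (Nat.log R (N ^ (q.2 + 1)) + 1) :=
            (Nat.lt_pow_succ_log_self hR _).le
        _ = R * R ^ Nat.log R (N ^ (p.2 + 1)) := by
          rw [((mem_basePairs hN hR).1 hp).2.2, ((mem_basePairs hN hR).1 hq).2.2, pow_succ, mul_comm]
        _ ≤ R * N ^ (p.2 + 1) :=
          Nat.mul_le_mul_left _ (Nat.pow_log_le_self R (by positivity))
    omega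
  calc (basePairs N R m n).card ≤
        ((basePairs N R m n).image Prod.fst ×ˢ (basePairs N R m n).image Prod.snd).card :=
        Finset.card_le_card Finset.subset_product
    _ ≤ R ^ 2 := by
      rw [Finset.card_product, sq]
      exact Nat.mul_le_mul h1 h2

/-- Rounding `N ^ i` up and `N ^ (j + 1)` down each loses at most a factor `R`. -/
theorem pow_sub_mul_pow_lt {N R i j : ℕ} (hN : 1 < N) (hR : 1 < R) (hij : i ≤ j) :
    N ^ (j - i + 1) * R ^ Nat.clog R (N ^ i) < R ^ (Nat.log R (N ^ (j + 1)) + 2) := by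
  calc N ^ (j - i + 1) * R ^ Nat.clog R (N ^ i) ≤ N ^ (j - i + 1) * (R * N ^ i) :=
        Nat.mul_le_mul_left _ (Nat.pow_clog_le_mul hR (by positivity))
    _ = R * N ^ (j + 1) := by
      rw [show j + 1 = (j - i + 1) + i by omega, pow_add]; ring
    _ < R * R ^ (Nat.log R (N ^ (j + 1)) + 1) :=
      Nat.mul_lt_mul_of_pos_left (Nat.lt_pow_succ_log_self hR _) (by omega)
    _ = R ^ (Nat.log R (N ^ (j + 1)) + 2) := by ring

/-! ### Rich implies winning -/

theorem IsMCantorRich.isEpsCantorWinningOn {B₀ : RealBall} {E : Set ℝ} {M ε₀ : ℝ} {N : ℕ}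
    (h : IsMCantorRich B₀ M E) (hMN : M < N) (hN : 1 < N) (hε₀ : (N : ℝ) ^ ε₀ = 4)
    (hε₀1 : ε₀ ≤ 1) : IsEpsCantorWinningOn ε₀ B₀ E := by
  intro ε _ hεε₀
  refine ⟨2, one_le_two, fun R hR => ?_⟩
  have hR1 : 1 < R := hR
  have hR' : (2 : ℝ) ≤ R := by exact_mod_cast hR
  have hRpos : (0 : ℝ) < R := by linarith
  have hNpos : (0 : ℝ) < N := by positivity
  have hone : (1 : ℝ) < 9 * (R : ℝ) ^ 4 := by
    have : (1 : ℝ) ≤ (R : ℝ) ^ 4 := one_le_pow₀ (by linarith)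
    linarith
  -- In `9 * R ^ 4`, the 9 pays for the change of base, one `R ^ 2` for the number of pairs and the
  -- other for rounding.
  obtain ⟨r, K, ⟨hr, 𝓑, 𝓐, hcon, rfl⟩, hKE, hsum⟩ :=
    h N hMN (9 * (R : ℝ) ^ 4)⁻¹ (by positivity) (inv_lt_one_of_one_lt₀ hone)
  have hdiv : (N : ℝ) / 4 = (N : ℝ) ^ (1 - ε₀) := by
    rw [Real.rpow_sub hNpos, Real.rpow_one, hε₀]
  have hrle : ∀ i j, i ≤ j →
      r i j ≤ (9 * (R : ℝ) ^ 4)⁻¹ * ((N : ℝ) ^ (j - i + 1)) ^ (1 - ε₀) := by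
    intro i j hij
    have h1 : (4 / (N : ℝ)) ^ (j - i + 1) * r i j ≤ (9 * (R : ℝ) ^ 4)⁻¹ := by
      refine le_trans ?_ (hsum j)
      exact Finset.single_le_sum (f := fun m => (4 / (N : ℝ)) ^ (j - m + 1) * r m j)
        (fun m hm => mul_nonneg (by positivity) (hr m j (by simpa [Nat.lt_succ_iff] using hm)))
        (Finset.mem_range.2 (by omega))
    have h2 : ((N : ℝ) ^ (j - i + 1)) ^ (1 - ε₀) = ((N : ℝ) / 4) ^ (j - i + 1) := by
      rw [hdiv, ← Real.rpow_natCast, ← Real.rpow_natCast, ← Real.rpow_mul hNpos.le,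
        ← Real.rpow_mul hNpos.le, mul_comm]
    rw [h2, ← div_le_iff₀ (by positivity), div_eq_mul_inv, ← inv_pow, inv_div, mul_comm]
    exact h1
  have hrpow : ∀ x : ℝ, 1 ≤ x → x ^ (1 - ε₀) ≤ x := fun x hx => by
    simpa using Real.rpow_le_rpow_of_exponent_le hx (show 1 - ε₀ ≤ 1 by linarith)
  obtain ⟨K, hK, hKsub⟩ := hcon.exists_isCantorSet_subset hr (by omega) (by omega : 0 < R)
    (basePairs N R) (fun m n _ p hp => by
      obtain ⟨h1, h2, h3⟩ := (mem_basePairs hN hR1).1 hp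
      refine ⟨h1, ?_, ?_⟩
      · rw [← h2]; exact Nat.le_pow_clog hR1 _
      · rw [← h3]; exact Nat.pow_log_le_self R (by positivity))
    (fun i j hij hrij => by
      -- Otherwise `N ^ (j - i + 1) ≤ R ^ 2`, and the choice of `y` gives `r i j < 1`.
      have hlt : Nat.clog R (N ^ i) < Nat.log R (N ^ (j + 1)) := by
        by_contra! hle
        have h1 := (pow_sub_mul_pow_lt hN hR1 hij).trans_le
          (Nat.pow_le_pow_right (by omega) (Nat.add_le_add_right hle 2))
        rw [pow_add R, mul_comm] at h1
        have h2 : N ^ (j - i + 1) ≤ R ^ 2 := (Nat.lt_of_mul_lt_mul_left h1).le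
        have h3 : ((N : ℝ) ^ (j - i + 1)) ≤ (R : ℝ) ^ 2 := by exact_mod_cast h2
        have h4 := hrpow _ (one_le_pow₀ (by exact_mod_cast hN.le) : (1 : ℝ) ≤ (N : ℝ) ^ (j - i + 1))
        have h5 : (9 * (R : ℝ) ^ 4)⁻¹ * ((N : ℝ) ^ (j - i + 1)) ^ (1 - ε₀) ≤
            (9 * (R : ℝ) ^ 4)⁻¹ * (R : ℝ) ^ 2 := by gcongr; exact h4.trans h3
        have h6 : (9 * (R : ℝ) ^ 4)⁻¹ * (R : ℝ) ^ 2 < 1 := by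
          rw [inv_mul_lt_one₀ (by positivity)]
          have : (1 : ℝ) ≤ (R : ℝ) ^ 2 := one_le_pow₀ (by linarith)
          nlinarith
        linarith [hrle i j hij]
      exact ⟨_, Nat.log R (N ^ (j + 1)) - 1, Nat.le_sub_one_of_lt hlt,
        (mem_basePairs hN hR1).2 ⟨hij, rfl, by simp only; omega⟩⟩)
  refine ⟨_, K, hK, hKsub.trans hKE, fun m n hmn => ?_⟩
  have hexp : ((n - m + 1 : ℕ) : ℝ) = (n : ℝ) - m + 1 := by
    push_cast [Nat.cast_sub hmn]; ring
  rw [← hexp]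
  have hterm : ∀ p ∈ basePairs N R m n, 9 * r p.1 p.2 ≤
      ((R : ℝ) ^ 2)⁻¹ * ((R : ℝ) ^ (n - m + 1)) ^ (1 - ε₀) := by
    intro p hp
    obtain ⟨h1, h2, h3⟩ := (mem_basePairs hN hR1).1 hp
    have h4 := pow_sub_mul_pow_lt hN hR1 h1
    rw [h2, h3, show n + 1 + 2 = (n - m + 1 + 2) + m by omega, pow_add R _ m] at h4
    have h5 : (N : ℝ) ^ (p.2 - p.1 + 1) ≤ (R : ℝ) ^ (n - m + 1) * (R : ℝ) ^ 2 := by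
      rw [← pow_add]
      exact_mod_cast (Nat.lt_of_mul_lt_mul_right h4).le
    calc 9 * r p.1 p.2
        ≤ 9 * ((9 * (R : ℝ) ^ 4)⁻¹ * ((N : ℝ) ^ (p.2 - p.1 + 1)) ^ (1 - ε₀)) := by
          gcongr; exact hrle _ _ h1
      _ ≤ 9 * ((9 * (R : ℝ) ^ 4)⁻¹ * ((R : ℝ) ^ (n - m + 1) * (R : ℝ) ^ 2) ^ (1 - ε₀)) := by
          have : 0 ≤ 1 - ε₀ := by linarith
          gcongr
      _ = ((R : ℝ) ^ 4)⁻¹ * (((R : ℝ) ^ (n - m + 1)) ^ (1 - ε₀) * ((R : ℝ) ^ 2) ^ (1 - ε₀)) := by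
          rw [Real.mul_rpow (by positivity) (by positivity)]
          field_simp
      _ ≤ ((R : ℝ) ^ 4)⁻¹ * (((R : ℝ) ^ (n - m + 1)) ^ (1 - ε₀) * (R : ℝ) ^ 2) := by
          gcongr
          exact hrpow _ (one_le_pow₀ (by linarith))
      _ = ((R : ℝ) ^ 2)⁻¹ * ((R : ℝ) ^ (n - m + 1)) ^ (1 - ε₀) := by
          field_simp
  calc ∑ p ∈ basePairs N R m n, 9 * r p.1 p.2
      ≤ (basePairs N R m n).card • (((R : ℝ) ^ 2)⁻¹ * ((R : ℝ) ^ (n - m + 1)) ^ (1 - ε₀)) :=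
        Finset.sum_le_card_nsmul _ _ _ hterm
    _ ≤ (R : ℝ) ^ 2 * (((R : ℝ) ^ 2)⁻¹ * ((R : ℝ) ^ (n - m + 1)) ^ (1 - ε₀)) := by
        rw [nsmul_eq_mul]
        gcongr
        exact_mod_cast card_basePairs_le hN hR1 m n
    _ = (R : ℝ) ^ (((n - m + 1 : ℕ) : ℝ) * (1 - ε₀)) := by
        rw [mul_inv_cancel_left₀ (by positivity), Real.rpow_mul hRpos.le, Real.rpow_natCast]
    _ ≤ (R : ℝ) ^ (((n - m + 1 : ℕ) : ℝ) * (1 - ε)) := by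
        refine Real.rpow_le_rpow_of_exponent_le (by linarith) ?_
        gcongr

/-! ### Winning implies rich -/

theorem sum_range_ite_pow_le {q : ℝ} (hq0 : 0 ≤ q) (hq1 : q < 1) (k n : ℕ) :
    ∑ m ∈ Finset.range (n + 1), (if k ≤ n - m + 1 then q ^ (n - m + 1) else 0) ≤
      q ^ k / (1 - q) := by
  have h := Finset.sum_range_reflect (fun j => if k ≤ j + 1 then q ^ (j + 1) else 0) (n + 1)
  simp only [Nat.add_sub_cancel] at h
  rw [h, Finset.range_eq_Ico, Finset.sum_Ico_add' (fun j => if k ≤ j then q ^ j else 0) 0 (n + 1) 1,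
    ← Finset.sum_filter]
  refine le_trans (Finset.sum_le_sum_of_subset_of_nonneg (t := Finset.Ico k (n + 2)) ?_
    fun _ _ _ => by positivity) (geom_sum_Ico_le_of_lt_one hq0 hq1)
  intro j hj
  simp only [Finset.mem_filter, Finset.mem_Ico] at hj ⊢
  omega

theorem IsEpsCantorWinningOn.isMCantorRich {B₀ : RealBall} {E : Set ℝ} {ε₀ : ℝ}
    (h : IsEpsCantorWinningOn ε₀ B₀ E) (hε₀ : 0 < ε₀) (hε₀1 : ε₀ ≤ 1) :
    IsMCantorRich B₀ ((4 : ℝ) ^ (1 / ε₀)) E := by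
  intro R hR y hy _
  have h4 : (4 : ℝ) ≤ (4 : ℝ) ^ (1 / ε₀) := by
    simpa using Real.rpow_le_rpow_of_exponent_le (by norm_num : (1 : ℝ) ≤ 4)
      ((one_le_div hε₀).2 hε₀1)
  have hR4 : (4 : ℝ) < R := h4.trans_lt hR
  have hRpos : (0 : ℝ) < R := by linarith
  have hR1 : 1 < R := by exact_mod_cast (by linarith : (1 : ℝ) < R)
  have hlogR : 0 < Real.log R := Real.log_pos (by linarith)
  have hlog4 : 0 < Real.log 4 := Real.log_pos (by norm_num)
  have hlt : Real.log 4 / Real.log R < ε₀ := by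
    have := Real.log_lt_log (by positivity) hR
    rw [Real.log_rpow (by norm_num), one_div, inv_mul_lt_iff₀ hε₀] at this
    rwa [div_lt_iff₀ hlogR]
  obtain ⟨ε, hε, hεε₀⟩ := exists_between hlt
  have hε0 : 0 < ε := (div_pos hlog4 hlogR).trans hε
  have hRε : 4 < (R : ℝ) ^ ε := by
    rw [← Real.log_lt_log_iff (by norm_num) (by positivity), Real.log_rpow hRpos]
    rwa [div_lt_iff₀ hlogR] at hε
  set q : ℝ := 4 / (R : ℝ) ^ ε with hq
  have hq0 : 0 ≤ q := by positivity
  have hq1 : q < 1 := by rwa [hq, div_lt_one (by positivity)]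
  obtain ⟨Rε, -, hwin⟩ := h ε hε0 hεε₀
  obtain ⟨k, hk, hkRε, hk1⟩ : ∃ k : ℕ, 9 * (q ^ k / (1 - q)) ≤ y ∧ Rε ≤ k ∧ 1 ≤ k := by
    have ht : Filter.Tendsto (fun k : ℕ => 9 * (q ^ k / (1 - q))) Filter.atTop (nhds 0) := by
      simpa using ((tendsto_pow_atTop_nhds_zero_of_lt_one hq0 hq1).div_const (1 - q)).const_mul 9
    exact ((ht.eventually (ge_mem_nhds hy)).and
      ((Filter.eventually_ge_atTop Rε).and (Filter.eventually_ge_atTop 1))).exists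
  obtain ⟨r, K, ⟨hr, 𝓑, 𝓐, hcon, rfl⟩, hKE, hrle⟩ :=
    hwin (R ^ k) (hkRε.trans (Nat.lt_pow_self hR1).le)
  -- Level `i` in base `R ^ k` is exactly level `k * i` in base `R`, so no rounding occurs and each
  -- `P m n` has at most one element.
  let P : ℕ → ℕ → Finset (ℕ × ℕ) := fun m n =>
    {p ∈ Finset.range (n + 1) ×ˢ Finset.range (n + 1) |
      p.1 ≤ p.2 ∧ k * p.1 = m ∧ k * (p.2 + 1) = n + 1}
  have hPmem : ∀ m n p, p ∈ P m n → p.1 ≤ p.2 ∧ k * p.1 = m ∧ k * (p.2 + 1) = n + 1 :=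
    fun m n p hp => (Finset.mem_filter.1 hp).2
  obtain ⟨K, hK, hKsub⟩ := hcon.exists_isCantorSet_subset hr (by positivity) (by omega : 0 < R) P
    (fun m n _ p hp => by
      obtain ⟨h1, h2, h3⟩ := hPmem m n p hp
      rw [← pow_mul, ← pow_mul, h2, h3]
      exact ⟨h1, le_rfl, le_rfl⟩)
    (fun i j hij _ => by
      have h1 : k * i ≤ k * j := Nat.mul_le_mul_left _ hij
      have h2 : j ≤ k * j := Nat.le_mul_of_pos_left _ hk1
      have h3 : k * (j + 1) = k * j + k := by ring
      refine ⟨k * i, k * (j + 1) - 1, by omega, Finset.mem_filter.2 ⟨?_, hij, rfl, by simp only; omega⟩⟩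
      rw [Finset.mem_product, Finset.mem_range, Finset.mem_range]
      constructor <;> simp only <;> omega)
  refine ⟨_, K, hK, hKsub.trans hKE, fun n => ?_⟩
  calc ∑ m ∈ Finset.range (n + 1), (4 / (R : ℝ)) ^ (n - m + 1) * ∑ p ∈ P m n, 9 * r p.1 p.2
      ≤ ∑ m ∈ Finset.range (n + 1), 9 * (if k ≤ n - m + 1 then q ^ (n - m + 1) else 0) := by
        refine Finset.sum_le_sum fun m hm => ?_
        have hmn : m ≤ n := Nat.lt_succ_iff.1 (Finset.mem_range.1 hm)
        obtain hP | ⟨p, hp⟩ := (P m n).eq_empty_or_nonempty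
        · rw [hP, Finset.sum_empty, mul_zero]
          positivity
        · obtain ⟨h1, h2, h3⟩ := hPmem m n p hp
          have hPp : P m n = {p} := by
            refine Finset.eq_singleton_iff_unique_mem.2 ⟨hp, fun p' hp' => ?_⟩
            obtain ⟨-, h2', h3'⟩ := hPmem m n p' hp'
            have h5 := Nat.eq_of_mul_eq_mul_left hk1 (h2'.trans h2.symm)
            have h6 := Nat.eq_of_mul_eq_mul_left hk1 (h3'.trans h3.symm)
            exact Prod.ext h5 (by omega)
          have hmul : k * (p.2 - p.1 + 1) = n - m + 1 := by
            have : k * (p.2 - p.1 + 1) + k * p.1 = k * (p.2 + 1) := by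
              rw [← mul_add]; congr 1; omega
            omega
          have hk' : k ≤ n - m + 1 := hmul ▸ Nat.le_mul_of_pos_right _ (by omega)
          rw [hPp, Finset.sum_singleton, if_pos hk']
          have hexp : (p.2 : ℝ) - p.1 + 1 = ((p.2 - p.1 + 1 : ℕ) : ℝ) := by
            push_cast [Nat.cast_sub h1]; ring
          have h7 := hrle p.1 p.2 h1
          have h8 : (((R ^ k : ℕ) : ℝ)) ^ (((p.2 : ℝ) - p.1 + 1) * (1 - ε)) =
              ((R : ℝ) ^ (1 - ε)) ^ (n - m + 1) := by
            rw [hexp, Real.rpow_mul (by positivity), Real.rpow_natCast, Nat.cast_pow, ← pow_mul,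
              hmul, ← Real.rpow_natCast, ← Real.rpow_natCast, ← Real.rpow_mul hRpos.le,
              ← Real.rpow_mul hRpos.le, mul_comm]
          have h9 : q = 4 / R * (R : ℝ) ^ (1 - ε) := by
            rw [hq, Real.rpow_sub hRpos, Real.rpow_one]
            field_simp
          rw [h8] at h7
          calc _ ≤ (4 / (R : ℝ)) ^ (n - m + 1) * (9 * ((R : ℝ) ^ (1 - ε)) ^ (n - m + 1)) := by
                gcongr
            _ = _ := by rw [h9, mul_pow]; ring
    _ ≤ 9 * (q ^ k / (1 - q)) := by
        rw [← Finset.mul_sum]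
        gcongr
        exact sum_range_ite_pow_le hq0 hq1 k n
    _ ≤ y := hk

/-! ### The equation for `ε` and the conclusion -/

theorem eq_four_rpow_one_div_iff {x ε : ℝ} (hx : 1 < x) (hε : 0 < ε) :
    x = (4 : ℝ) ^ (1 / ε) ↔ ε = Real.log 4 / Real.log x := by
  have hlogx : 0 < Real.log x := Real.log_pos hx
  rw [← Real.log_injOn_pos.eq_iff (Set.mem_Ioi.2 (by linarith)) (Set.mem_Ioi.2 (by positivity)),
    Real.log_rpow (by norm_num)]
  field_simp

theorem mainTheorem9 (B₀ : RealBall) (E : Set ℝ) :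
    (IsCantorRichIn B₀ E ↔ IsCantorWinningOn B₀ E) ∧
    (∀ ε : ℝ, 0 < ε → ε ≤ 1 → IsEpsCantorWinningOn ε B₀ E →
      IsMCantorRich B₀ ((4 : ℝ) ^ (1 / ε)) E) ∧
    (∀ M : ℝ, 4 ≤ M → IsMCantorRich B₀ M E →
      (∃! ε : ℝ, 0 < ε ∧ (⌊M⌋ : ℝ) + 1 = (4 : ℝ) ^ (1 / ε)) ∧
      ∀ ε : ℝ, 0 < ε → (⌊M⌋ : ℝ) + 1 = (4 : ℝ) ^ (1 / ε) →
        ε ≤ 1 ∧ IsEpsCantorWinningOn ε B₀ E) := by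
  have unique : ∀ M : ℝ, 4 ≤ M → ∃! ε : ℝ, 0 < ε ∧ (⌊M⌋ : ℝ) + 1 = (4 : ℝ) ^ (1 / ε) := by
    intro M hM
    have hx : 1 < (⌊M⌋ : ℝ) + 1 := by linarith [Int.lt_floor_add_one M]
    have hpos : 0 < Real.log 4 / Real.log ((⌊M⌋ : ℝ) + 1) :=
      div_pos (Real.log_pos (by norm_num)) (Real.log_pos hx)
    exact ⟨_, ⟨hpos, (eq_four_rpow_one_div_iff hx hpos).2 rfl⟩,
      fun ε hε => (eq_four_rpow_one_div_iff hx hε.1).1 hε.2⟩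
  have winning : ∀ M : ℝ, 4 ≤ M → IsMCantorRich B₀ M E → ∀ ε : ℝ, 0 < ε →
      (⌊M⌋ : ℝ) + 1 = (4 : ℝ) ^ (1 / ε) → ε ≤ 1 ∧ IsEpsCantorWinningOn ε B₀ E := by
    intro M hM hrich ε hε heq
    have hMlt := Int.lt_floor_add_one M
    have hε1 : ε ≤ 1 := by
      by_contra! hlt
      have : (4 : ℝ) ^ (1 / ε) ≤ (4 : ℝ) ^ (1 : ℝ) :=
        Real.rpow_le_rpow_of_exponent_le (by norm_num) ((div_le_one hε).2 hlt.le)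
      rw [Real.rpow_one] at this
      linarith
    -- The base is the least integer above `M`; the equation for `ε` says `N ^ ε = 4`.
    obtain ⟨N, hN⟩ : ∃ N : ℕ, (N : ℝ) = (⌊M⌋ : ℝ) + 1 := by
      refine ⟨⌊M⌋₊ + 1, ?_⟩
      rw [Nat.cast_add_one, natCast_floor_eq_intCast_floor (by linarith)]
    refine ⟨hε1, hrich.isEpsCantorWinningOn (N := N) (by linarith) ?_ ?_ hε1⟩
    · exact_mod_cast (by linarith : (1 : ℝ) < N)
    · rw [hN, heq, ← Real.rpow_mul (by norm_num), one_div_mul_cancel hε.ne', Real.rpow_one]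
  refine ⟨⟨?_, ?_⟩, fun ε hε hε1 h => h.isMCantorRich hε hε1,
    fun M hM h => ⟨unique M hM, winning M hM h⟩⟩
  · rintro ⟨M, hM, h⟩
    obtain ⟨ε, ⟨hε, heq⟩, -⟩ := unique M hM
    obtain ⟨hε1, hwin⟩ := winning M hM h ε hε heq
    exact ⟨ε, hε, hε1, hwin⟩
  · rintro ⟨ε, hε, hε1, h⟩
    refine ⟨_, ?_, h.isMCantorRich hε hε1⟩
    simpa using Real.rpow_le_rpow_of_exponent_le (by norm_num : (1 : ℝ) ≤ 4)
      ((one_le_div hε).2 hε1)
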